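/- For a finite-dimensional division algebra $D$ with center a field $K$, a maximal subfield of $D$ is a maximal element (under inclusion) of the set of fields $E$ with $K\subseteq E\subseteq D$. Two finite-dimensional division algebras with center $K$ are called weakly isomorphic if they have the same set of $K$-isomorphism classes of maximal subfields. The genus of $D$ is the set of $K$-isomorphism classes of finite-dimensional division algebras $D'$ with center $K$ that are weakly isomorphic to $D$. **Theorem A.** There exist a field $K$ of characteristic different from $2$ and a quaternion division algebra $D$ with center $K$ (that is, a division algebra of the form $D\cong\left(\frac{a,b}{K}\right)$ with $a,b\in K^\times$) whose genus is infinite. -/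

import Mathlib

universe u

/-- A (finite-dimensional) division algebra with center `k`. -/
structure CentralDivisionAlgebra (k : Type u) [Field k] where
  carrier : Type u
  [divisionRing : DivisionRing carrier]
  [algebra : Algebra k carrier]
  [isCentral : Algebra.IsCentral k carrier]
  [finiteDimensional : FiniteDimensional k carrier]

attribute [instance] CentralDivisionAlgebra.divisionRing CentralDivisionAlgebra.algebra
  CentralDivisionAlgebra.isCentral CentralDivisionAlgebra.finiteDimensional

/-- A field extension of `k`. -/
structure FieldExtension (k : Type u) [Field k] where
  carrier : Type u
  [commRing : CommRing carrier]
  [algebra : Algebra k carrier]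
  isField : IsField carrier

attribute [instance] FieldExtension.commRing FieldExtension.algebra

/-- Isomorphism of field extensions of `k`. -/
def FieldExtension.isoSetoid (k : Type u) [Field k] : Setoid (FieldExtension k) where
  r E E' := Nonempty (E.carrier ≃ₐ[k] E'.carrier)
  iseqv :=
    { refl := fun _ => ⟨AlgEquiv.refl⟩
      symm := fun ⟨e⟩ => ⟨e.symm⟩
      trans := fun ⟨e⟩ ⟨f⟩ => ⟨e.trans f⟩ }

/-- Isomorphism classes of field extensions of `k`. -/
def FieldExtension.IsoClass (k : Type u) [Field k] : Type (u + 1) :=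
  Quotient (FieldExtension.isoSetoid k)

/-- The isomorphism class of a field extension of `k`. -/
def FieldExtension.isoClass {k : Type u} [Field k] (E : FieldExtension k) :
    FieldExtension.IsoClass k :=
  Quotient.mk (FieldExtension.isoSetoid k) E

namespace CentralDivisionAlgebra

variable {k : Type u} [Field k]

/-- `E` is a subfield with `k ⊆ E ⊆ D`, and is maximal under inclusion among these. -/
def IsMaximalSubfield (D : CentralDivisionAlgebra k) (E : Subalgebra k D.carrier) : Prop :=
  Maximal (fun E' : Subalgebra k D.carrier => IsField E') E

/-- A subfield `k ⊆ E ⊆ D`, regarded as a field extension of `k`. -/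
def subfieldExtension (D : CentralDivisionAlgebra k) (E : Subalgebra k D.carrier)
    (hE : IsField E) : FieldExtension k :=
  letI : CommRing E := { (inferInstance : Ring E) with mul_comm := hE.mul_comm }
  { carrier := E
    isField := hE }

/-- The maximal subfield spectrum `Max(D)`: the set of isomorphism classes (over `k`) of
maximal subfields of `D`. -/
def maximalSubfieldSpectrum (D : CentralDivisionAlgebra k) : Set (FieldExtension.IsoClass k) :=
  {c | ∃ (E : Subalgebra k D.carrier) (hE : D.IsMaximalSubfield E),
    (D.subfieldExtension E hE.prop).isoClass = c}

/-- Two central division algebras over `k` are weakly isomorphic if they have the same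
maximal subfield spectrum. -/
def WeaklyIsomorphic (D D' : CentralDivisionAlgebra k) : Prop :=
  D.maximalSubfieldSpectrum = D'.maximalSubfieldSpectrum

/-- Isomorphism of `k`-algebras. -/
def isoSetoid (k : Type u) [Field k] : Setoid (CentralDivisionAlgebra k) where
  r D D' := Nonempty (D.carrier ≃ₐ[k] D'.carrier)
  iseqv :=
    { refl := fun _ => ⟨AlgEquiv.refl⟩
      symm := fun ⟨e⟩ => ⟨e.symm⟩
      trans := fun ⟨e⟩ ⟨f⟩ => ⟨e.trans f⟩ }

/-- Isomorphism classes of central division algebras over `k`. -/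
def IsoClass (k : Type u) [Field k] : Type (u + 1) :=
  Quotient (isoSetoid k)

/-- The isomorphism class of a central division algebra over `k`. -/
def isoClass (D : CentralDivisionAlgebra k) : IsoClass k :=
  Quotient.mk (isoSetoid k) D

/-- The genus of `D`: the set of isomorphism classes of central division algebras over `k`
that are weakly isomorphic to `D`. -/
def genus (D : CentralDivisionAlgebra k) : Set (IsoClass k) :=
  {c | ∃ D' : CentralDivisionAlgebra k, D.WeaklyIsomorphic D' ∧ D'.isoClass = c}

/-- For `k` of characteristic not `2`: `D` is a quaternion algebra, that is, it has the form
`(a, b / k)`, with basis `1, i, j, ij` and `i² = a`, `j² = b`, `ij = -ji`, where `a, b ∈ kˣ`. -/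
def IsQuaternion (D : CentralDivisionAlgebra k) : Prop :=
  ∃ a b : k, a ≠ 0 ∧ b ≠ 0 ∧ Nonempty (D.carrier ≃ₐ[k] QuaternionAlgebra k a 0 b)

end CentralDivisionAlgebra

/-! The field is a countable subfield `K` of `ℂ` carrying infinitely many pairwise non-isomorphic
quaternion division algebras `(-1, p_s)`, with `p_s` primes congruent to 3 mod 4, such that each of
them contains every quadratic extension of `K`. Maximal subfields of a quaternion division algebra
are exactly its subfields `K(√d)` with `d` not a square, so all these algebras have the same
spectrum.

Over `ℚ` the algebras `(-1, p_s)` and `(-1, p_s p_t)`, `s ≠ t`, are division, because sums of two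
rational squares have even valuation at such primes. The second kind certifies that `(-1, p_s)` and
`(-1, p_t)` are not isomorphic. To make a nonsquare `d` a square in `(a, b)`, adjoin a generic point
of the quadric `a X² + b Y² - a b Z² = d`. This is repeated for all `d` and all `s`
(`Subfield.exists_closed_under`); countability leaves room in `ℂ` for new transcendentals.

The crux is that no algebra of the family splits on the way
(`eq_zero_of_redNorm_eq_zero_of_quadric`). The function field is `k(y)(x)(√δ)` with `δ = d a x² + d
b (y² - a)`. If a division algebra `Q` over `k` splits there, `δ` is a square in `Q` over `k(y)(x)`,
hence over `k(y)[x]` by a noncommutative Cassels argument (`exists_mul_self_eq`). The root is linear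
in `x`, and its coefficients anticommute and square to `d a` and `d b (y² - a)`. The same argument
in `y` makes `d a` a square in `Q` over `k`, so `Q = (d a, B)` with `B` in `k`. By Skolem–Noether,
`d b (y² - a) / B` is then a norm from `k(y)(√(d a))`. This is impossible at the place `y² - a`: its
residue field is `k(√a)`, where `d a` is not a square (`eq_zero_of_norm_eq`). -/

open Polynomial
open scoped Quaternion IntermediateField

namespace QuaternionAlgebra

/-! ### Reduced norm and base change. -/

section Norm

variable {R : Type*} [CommRing R] {a b : R}

/-- The reduced norm of the quaternion algebra `(a, b / R)`. -/
def redNorm (z : ℍ[R,a,b]) : R :=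
  z.re ^ 2 - a * z.imI ^ 2 - b * z.imJ ^ 2 + a * b * z.imK ^ 2

theorem mul_star_eq_redNorm (z : ℍ[R,a,b]) : z * star z = coe (redNorm z) := by
  ext <;> simp <;> first | (unfold redNorm; ring1) | ring1

theorem star_mul_eq_redNorm (z : ℍ[R,a,b]) : star z * z = coe (redNorm z) := by
  ext <;> simp <;> first | (unfold redNorm; ring1) | ring1

theorem redNorm_mul (z w : ℍ[R,a,b]) : redNorm (z * w) = redNorm z * redNorm w := by
  simp [redNorm]; ring

theorem redNorm_coe (r : R) : redNorm (r : ℍ[R,a,b]) = r ^ 2 := by simp [redNorm]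

theorem redNorm_zero : redNorm (0 : ℍ[R,a,b]) = 0 := by simp [redNorm]

theorem redNorm_star (z : ℍ[R,a,b]) : redNorm (star z) = redNorm z := by simp [redNorm]

theorem mul_self_of_re_eq_zero {z : ℍ[R,a,b]} (h : z.re = 0) :
    z * z = coe (-redNorm z) := by
  ext <;> simp [h] <;> first | (unfold redNorm; rw [h]; ring1) | ring1

variable (R a b) in
/-- The reduced norm form of `(a, b / R)` is anisotropic. -/
def NormAnisotropic : Prop :=
  ∀ z : ℍ[R,a,b], redNorm z = 0 → z = 0

theorem NormAnisotropic.mul_eq_zero [NoZeroDivisors R] (h : NormAnisotropic R a b)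
    {z w : ℍ[R,a,b]} (hzw : z * w = 0) : z = 0 ∨ w = 0 := by
  have := redNorm_mul z w
  rw [hzw, redNorm_zero] at this
  rcases _root_.mul_eq_zero.1 this.symm with h1 | h1
  · exact Or.inl (h _ h1)
  · exact Or.inr (h _ h1)

theorem NormAnisotropic.noZeroDivisors [NoZeroDivisors R] (h : NormAnisotropic R a b) :
    NoZeroDivisors ℍ[R,a,b] where
  eq_zero_or_eq_zero_of_mul_eq_zero := h.mul_eq_zero

end Norm

section Map

variable {R S : Type*} [CommRing R] [CommRing S] {a b : R} {a' b' : S}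

/-- Base change of quaternion algebras, coordinatewise. -/
def map (f : R →+* S) (ha : f a = a') (hb : f b = b') : ℍ[R,a,b] →+* ℍ[S,a',b'] where
  toFun z := ⟨f z.re, f z.imI, f z.imJ, f z.imK⟩
  map_one' := by ext <;> simp
  map_mul' z w := by subst ha hb; ext <;> simp
  map_zero' := by ext <;> simp
  map_add' z w := by ext <;> simp

variable (f : R →+* S) (ha : f a = a') (hb : f b = b') (z : ℍ[R,a,b])

@[simp] theorem re_map : (map f ha hb z).re = f z.re := rfl
@[simp] theorem imI_map : (map f ha hb z).imI = f z.imI := rfl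
@[simp] theorem imJ_map : (map f ha hb z).imJ = f z.imJ := rfl
@[simp] theorem imK_map : (map f ha hb z).imK = f z.imK := rfl

theorem redNorm_map : redNorm (map f ha hb z) = f (redNorm z) := by
  subst ha hb; simp [redNorm]

theorem map_coe (r : R) : map f ha hb (coe r) = coe (f r) := by ext <;> simp

variable {f} in
theorem map_injective (hf : Function.Injective f) :
    Function.Injective (map f ha hb) := by
  intro z w h
  ext
  · exact hf (congrArg re h)
  · exact hf (congrArg imI h)
  · exact hf (congrArg imJ h)
  · exact hf (congrArg imK h)

end Map

/-! ### Quaternions over `k[X]`: Euclidean division and integrality of square roots. -/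

section Euclid

variable {k : Type*} [Field k] {a b : k}

/-- All coordinates of a quaternion with polynomial coefficients have degree at most `m`. -/
def DegreeLE (z : ℍ[k[X],C a,C b]) (m : ℕ) : Prop :=
  z.re.natDegree ≤ m ∧ z.imI.natDegree ≤ m ∧ z.imJ.natDegree ≤ m ∧ z.imK.natDegree ≤ m

/-- The quaternion of coefficients of `X ^ m`. -/
def coeffs (z : ℍ[k[X],C a,C b]) (m : ℕ) : ℍ[k,a,b] :=
  ⟨z.re.coeff m, z.imI.coeff m, z.imJ.coeff m, z.imK.coeff m⟩

theorem DegreeLE.natDegree_redNorm_le {z : ℍ[k[X],C a,C b]} {m : ℕ} (h : DegreeLE z m) :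
    (redNorm z).natDegree ≤ 2 * m := by
  obtain ⟨h0, h1, h2, h3⟩ := h
  have sq (p : k[X]) (hp : p.natDegree ≤ m) : (p ^ 2).natDegree ≤ 2 * m :=
    natDegree_pow_le_of_le 2 hp
  have csq (c : k) (p : k[X]) (hp : p.natDegree ≤ m) : (C c * p ^ 2).natDegree ≤ 2 * m :=
    (natDegree_C_mul_le _ _).trans (sq p hp)
  unfold redNorm
  rw [← C_mul]
  exact natDegree_add_le_of_degree_le (natDegree_sub_le_of_le
    (natDegree_sub_le_of_le (sq _ h0) (csq _ _ h1)) (csq _ _ h2) |>.trans (by simp)) (csq _ _ h3)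

theorem DegreeLE.coeff_redNorm {z : ℍ[k[X],C a,C b]} {m : ℕ} (h : DegreeLE z m) :
    (redNorm z).coeff (2 * m) = redNorm (coeffs z m) := by
  obtain ⟨h0, h1, h2, h3⟩ := h
  unfold redNorm coeffs
  rw [← C_mul]
  simp only [coeff_add, coeff_sub, coeff_C_mul, coeff_pow_of_natDegree_le h0,
    coeff_pow_of_natDegree_le h1, coeff_pow_of_natDegree_le h2, coeff_pow_of_natDegree_le h3]

/-- Anisotropy over `k` prevents cancellation of top coefficients: the quaternion of leading
coefficients has nonzero norm, so the norm has degree exactly twice the largest coordinate degree.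
-/
theorem redNorm_ne_zero_and_degreeLE (hk : NormAnisotropic k a b) {z : ℍ[k[X],C a,C b]}
    (hz : z ≠ 0) : redNorm z ≠ 0 ∧ DegreeLE z ((redNorm z).natDegree / 2) := by
  set m := max (max z.re.natDegree z.imI.natDegree) (max z.imJ.natDegree z.imK.natDegree) with hm
  have hle : DegreeLE z m := by
    refine ⟨?_, ?_, ?_, ?_⟩ <;> simp [hm]
  have hc : coeffs z m ≠ 0 := by
    intro h0
    have e0 : z.re.coeff m = 0 := congrArg re h0
    have e1 : z.imI.coeff m = 0 := congrArg imI h0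
    have e2 : z.imJ.coeff m = 0 := congrArg imJ h0
    have e3 : z.imK.coeff m = 0 := congrArg imK h0
    have key (p : k[X]) (hp : p.natDegree ≤ m) (hpc : p.coeff m = 0) :
        p.natDegree < m ∨ (p = 0 ∧ m = 0) := by
      rcases hp.lt_or_eq with h | h
      · exact Or.inl h
      · rw [← h, coeff_natDegree, leadingCoeff_eq_zero] at hpc
        right; simp [← h, hpc]
    have k0 := key _ hle.1 e0
    have k1 := key _ hle.2.1 e1
    have k2 := key _ hle.2.2.1 e2
    have k3 := key _ hle.2.2.2 e3
    by_cases hm0 : m = 0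
    · simp only [hm0, not_lt_zero, false_or, and_true] at k0 k1 k2 k3
      exact hz (by ext1 <;> assumption)
    · have : m < m := by
        conv_lhs => rw [hm]
        simp only [hm0, and_false, or_false] at k0 k1 k2 k3
        exact max_lt (max_lt k0 k1) (max_lt k2 k3)
      exact lt_irrefl _ this
  have hcn : (redNorm z).coeff (2 * m) ≠ 0 := by
    rw [hle.coeff_redNorm]
    exact fun h => hc (hk _ h)
  have hdeg : (redNorm z).natDegree = 2 * m :=
    le_antisymm hle.natDegree_redNorm_le (le_natDegree_of_ne_zero hcn)
  refine ⟨fun h => hcn (by simp [h]), ?_⟩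
  rw [hdeg, Nat.mul_div_cancel_left _ two_pos]
  exact hle

theorem NormAnisotropic.polynomial (hk : NormAnisotropic k a b) :
    NormAnisotropic k[X] (C a) (C b) := by
  intro z hz
  by_contra h
  exact (redNorm_ne_zero_and_degreeLE hk h).1 hz

/-- Divide `star e * p` by the norm `N` of `e` coordinatewise. The remainder is `star e * (p - e *
q)`, of norm `N * redNorm (p - e * q)` and degree at most `2 (deg N - 1)`. Hence right ideals are
principal. -/
theorem exists_quotient (hk : NormAnisotropic k a b) {e : ℍ[k[X],C a,C b]} (he : e ≠ 0)
    (p : ℍ[k[X],C a,C b]) :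
    ∃ q, p - e * q = 0 ∨ (redNorm (p - e * q)).natDegree < (redNorm e).natDegree := by
  set N := redNorm e with hN
  have hN0 : N ≠ 0 := fun h => he (hk.polynomial _ h)
  set s := star e * p with hs
  set q : ℍ[k[X],C a,C b] := ⟨s.re / N, s.imI / N, s.imJ / N, s.imK / N⟩ with hq
  set r : ℍ[k[X],C a,C b] := ⟨s.re % N, s.imI % N, s.imJ % N, s.imK % N⟩ with hr
  have hsr : star e * (p - e * q) = r := by
    rw [mul_sub, ← mul_assoc, star_mul_eq_redNorm, ← hs, ← hN, coe_mul_eq_smul]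
    have h (x : k[X]) : x - N * (x / N) = x % N := by
      rw [sub_eq_iff_eq_add, add_comm, EuclideanDomain.div_add_mod]
    ext1 <;> simp [hq, hr, h]
  refine ⟨q, or_iff_not_imp_left.2 fun hne => ?_⟩
  have hr0 : r ≠ 0 := by
    rw [← hsr]
    intro h
    rcases hk.polynomial.mul_eq_zero h with h | h
    · exact he (star_eq_zero.1 h)
    · exact hne h
  have hNr : N * redNorm (p - e * q) = redNorm r := by
    rw [← hsr, redNorm_mul, redNorm_star]
  have hNpos : 0 < N.natDegree := by
    by_contra h0
    have hu : IsUnit N := isUnit_iff_degree_eq_zero.2 (by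
      rw [degree_eq_natDegree hN0]; simp at h0; simp [h0])
    have hm (x : k[X]) : x % N = 0 := (EuclideanDomain.mod_eq_zero).2 hu.dvd
    exact hr0 (by ext1 <;> simp [hr, hm])
  have hdr : DegreeLE r (N.natDegree - 1) := by
    have h (x : k[X]) : (x % N).natDegree ≤ N.natDegree - 1 :=
      Nat.le_sub_one_of_lt (natDegree_mod_lt x hNpos.ne')
    exact ⟨h _, h _, h _, h _⟩
  have h1 := hdr.natDegree_redNorm_le
  rw [← hNr, natDegree_mul hN0 (fun h => hne (hk.polynomial _ h))] at h1
  omega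

/-- If `δ` is a square in the quaternion algebra over `k(X)`, then it is a square in the quaternion
algebra over `k[X]`. -/
theorem exists_mul_self_eq (hk : NormAnisotropic k a b) {P : ℍ[k[X],C a,C b]} {g δ : k[X]}
    (hg : g ≠ 0) (hP : P * P = coe (δ * g ^ 2)) : ∃ v : ℍ[k[X],C a,C b], v * v = coe δ := by
  have := hk.polynomial.noZeroDivisors
  obtain ⟨G, hG⟩ : ∃ G : ℍ[k[X],C a,C b], G = coe g := ⟨_, rfl⟩
  obtain ⟨D, hD⟩ : ∃ D : ℍ[k[X],C a,C b], D = coe δ := ⟨_, rfl⟩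
  have hcomm : ∀ z, G * z = z * G := fun z => hG ▸ coe_commutes g z
  have hcomm' : ∀ z, D * z = z * D := fun z => hD ▸ coe_commutes δ z
  replace hP : P * P = D * G * G := by
    rw [hP, hG, hD, ← coe_mul, ← coe_mul]; congr 1; ring
  rw [← hD]
  -- The right ideal generated by `P` and `G`. Since `P² = D G²`, left multiplication by `P` maps
  -- `I` into `G I`. With `I` generated by `e` this gives `P e = G e v`, so `v` is the conjugate of
  -- `P / g` by `e`, and its square is `δ`.
  let I : Set ℍ[k[X],C a,C b] := {e | ∃ s t, e = P * s + G * t}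
  have hgc : G ≠ 0 := fun h => hg (coe_injective ((hG.symm.trans h).trans coe_zero.symm))
  have hex : ∃ n e, e ∈ I ∧ e ≠ 0 ∧ (redNorm e).natDegree = n :=
    ⟨_, G, ⟨0, 1, by simp⟩, hgc, rfl⟩
  classical
  obtain ⟨e, heI, he0, hen⟩ := Nat.find_spec hex
  have hmin : ∀ x ∈ I, ∃ q, x = e * q := by
    intro x hx
    obtain ⟨q, hq⟩ := exists_quotient hk he0 x
    refine ⟨q, ?_⟩
    rcases hq with hq | hq
    · exact sub_eq_zero.1 hq
    · by_contra hne
      rw [hen] at hq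
      refine Nat.find_min hex hq ⟨_, ?_, sub_ne_zero.2 hne, rfl⟩
      obtain ⟨s, t, rfl⟩ := hx
      obtain ⟨s', t', hst⟩ := heI
      exact ⟨s - s' * q, t - t' * q, by rw [hst]; noncomm_ring⟩
  obtain ⟨s, t, hst⟩ := heI
  obtain ⟨v, hv⟩ := hmin (P * t + G * (D * s)) ⟨_, _, rfl⟩
  have hPe : P * e = G * (e * v) := by
    calc P * e = P * P * s + P * G * t := by rw [hst]; noncomm_ring
      _ = D * G * G * s + G * P * t := by rw [hP, hcomm P]
      _ = G * D * G * s + G * P * t := by rw [hcomm D]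
      _ = G * (D * G) * s + G * P * t := by rw [mul_assoc G]
      _ = G * (G * D) * s + G * P * t := by rw [hcomm D]
      _ = G * (P * t + G * (D * s)) := by noncomm_ring
      _ = G * (e * v) := by rw [hv]
  refine ⟨v, ?_⟩
  have h1 : P * (P * e) = G * (G * (e * (v * v))) := by
    calc P * (P * e) = P * G * e * v := by rw [hPe]; noncomm_ring
      _ = G * (P * e) * v := by rw [← hcomm P]; noncomm_ring
      _ = G * (G * (e * (v * v))) := by rw [hPe]; noncomm_ring
  have h2 : P * (P * e) = G * (G * (e * D)) := by
    calc P * (P * e) = P * P * e := by noncomm_ring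
      _ = D * (G * G * e) := by rw [hP]; noncomm_ring
      _ = G * (G * (e * D)) := by rw [hcomm']; noncomm_ring
  exact mul_left_cancel₀ he0 (mul_left_cancel₀ hgc (mul_left_cancel₀ hgc (h1.symm.trans h2)))

end Euclid

end QuaternionAlgebra

/-! ### Commutation and Skolem–Noether in quaternion division algebras. -/

namespace QuaternionAlgebra

section Field

variable {k : Type*} [Field k] {a b : k}

theorem NormAnisotropic.left_ne_zero (h : NormAnisotropic k a b) : a ≠ 0 := by
  rintro rfl
  exact one_ne_zero (congrArg imI (h ⟨0, 1, 0, 0⟩ (by simp [redNorm])))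

theorem NormAnisotropic.right_ne_zero (h : NormAnisotropic k a b) : b ≠ 0 := by
  rintro rfl
  exact one_ne_zero (congrArg imJ (h ⟨0, 0, 1, 0⟩ (by simp [redNorm])))

/-- A quaternion algebra with anisotropic norm form is a division ring. -/
abbrev NormAnisotropic.divisionRing (h : NormAnisotropic k a b) : DivisionRing ℍ[k,a,b] :=
  { (inferInstance : Ring ℍ[k,a,b]), (inferInstance : Nontrivial ℍ[k,a,b]) with
    inv := fun z => (redNorm z)⁻¹ • star z
    mul_inv_cancel := fun z hz => by
      change z * ((redNorm z)⁻¹ • star z) = 1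
      rw [mul_smul_comm, mul_star_eq_redNorm, smul_coe, inv_mul_cancel₀ (fun h' => hz (h z h')),
        coe_one]
    inv_zero := by
      change (redNorm (0 : ℍ[k,a,b]))⁻¹ • star (0 : ℍ[k,a,b]) = 0
      simp
    nnqsmul := _
    nnqsmul_def := fun _ _ => rfl
    qsmul := _
    qsmul_def := fun _ _ => rfl }

/-- The commutator is, up to nonzero factors, twice the cross product of the pure parts; when it
vanishes these are proportional. -/
theorem exists_eq_add_of_commute (h2 : (2 : k) ≠ 0) (h : NormAnisotropic k a b) {u z : ℍ[k,a,b]}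
    (hu : ∀ c : k, u ≠ coe c) (hz : z * u = u * z) :
    ∃ α β : k, z = coe α + coe β * u := by
  have ha := h.left_ne_zero
  have hb := h.right_ne_zero
  have e1 : z.imJ * u.imK = z.imK * u.imJ := by
    have := congrArg imI hz
    simp at this
    have h3 : (2 * b) * (z.imJ * u.imK - z.imK * u.imJ) = 0 := by linear_combination -this
    exact sub_eq_zero.1 ((mul_eq_zero.1 h3).resolve_left (mul_ne_zero h2 hb))
  have e2 : z.imI * u.imK = z.imK * u.imI := by
    have := congrArg imJ hz
    simp at this
    have h3 : (2 * a) * (z.imI * u.imK - z.imK * u.imI) = 0 := by linear_combination this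
    exact sub_eq_zero.1 ((mul_eq_zero.1 h3).resolve_left (mul_ne_zero h2 ha))
  have e3 : z.imI * u.imJ = z.imJ * u.imI := by
    have := congrArg imK hz
    simp at this
    have h3 : 2 * (z.imI * u.imJ - z.imJ * u.imI) = 0 := by linear_combination this
    exact sub_eq_zero.1 ((mul_eq_zero.1 h3).resolve_left h2)
  have key (β : k) (h1 : z.imI = β * u.imI) (h2 : z.imJ = β * u.imJ) (h3 : z.imK = β * u.imK) :
      ∃ α β : k, z = coe α + coe β * u :=
    ⟨z.re - β * u.re, β, by ext <;> simp [h1, h2, h3]⟩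
  by_cases hI : u.imI = 0
  · by_cases hJ : u.imJ = 0
    · by_cases hK : u.imK = 0
      · exact absurd (by ext <;> simp [hI, hJ, hK]) (hu u.re)
      · exact key (z.imK / u.imK) (by field_simp; linear_combination e2)
          (by field_simp; linear_combination e1) (by field_simp)
    · exact key (z.imJ / u.imJ) (by field_simp; linear_combination e3) (by field_simp)
          (by field_simp; linear_combination -e1)
  · exact key (z.imI / u.imI) (by field_simp) (by field_simp; linear_combination -e3)
      (by field_simp; linear_combination -e2)

theorem exists_not_commute (h2 : (2 : k) ≠ 0) (h : NormAnisotropic k a b) {u : ℍ[k,a,b]}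
    (hu : ∀ c : k, u ≠ coe c) : ∃ z, z * u - u * z ≠ 0 := by
  by_contra! hc
  have hi := hc ⟨0, 1, 0, 0⟩
  have hj := hc ⟨0, 0, 1, 0⟩
  have e1 := congrArg imK hi
  have e2 := congrArg imJ hi
  have e3 := congrArg imK hj
  simp at e1 e2 e3
  have ha := h.left_ne_zero
  refine hu u.re ?_
  ext
  · simp
  · exact (mul_eq_zero.1 (show 2 * u.imI = 0 by linear_combination -e3)).resolve_left h2
  · exact (mul_eq_zero.1 (show 2 * u.imJ = 0 by linear_combination e1)).resolve_left h2
  · exact (mul_eq_zero.1 (show (2 * a) * u.imK = 0 by linear_combination e2)).resolve_left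
      (mul_ne_zero h2 ha)

/-- Any nonzero commutator `z u - u z` serves: it has trace zero, and it anticommutes with `u`
because `u²` is central. -/
theorem exists_anticommute (h2 : (2 : k) ≠ 0) (h : NormAnisotropic k a b) {u : ℍ[k,a,b]} {A : k}
    (hu : ∀ c : k, u ≠ coe c) (hA : u * u = coe A) :
    ∃ (j : ℍ[k,a,b]) (B : k), j ≠ 0 ∧ j * j = coe B ∧ u * j = -(j * u) := by
  obtain ⟨z, hz⟩ := exists_not_commute h2 h hu
  refine ⟨z * u - u * z, _, hz, mul_self_of_re_eq_zero (by simp; ring), ?_⟩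
  calc u * (z * u - u * z) = u * z * u - u * u * z := by noncomm_ring
    _ = u * z * u - z * (u * u) := by rw [hA, coe_commutes]
    _ = -((z * u - u * z) * u) := by noncomm_ring

/-- Two square roots of `A` are conjugate, so `w` may be replaced by a conjugate `w'` anticommuting
with `u`. Then `w' j⁻¹` commutes with `u`, hence equals some `α + β u`, and squaring `w' = (α + β u)
j` produces the norm of `α + β u`. -/
theorem exists_norm_ratio (h2 : (2 : k) ≠ 0) (h : NormAnisotropic k a b)
    {u j v w : ℍ[k,a,b]} {A B C : k} (hA : A ≠ 0) (hu : u * u = coe A) (hv : v * v = coe A)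
    (hj : j * j = coe B) (hw : w * w = coe C) (huj : u * j = -(j * u)) (hvw : v * w = -(w * v))
    (hj0 : j ≠ 0) : ∃ α β : k, C = (α ^ 2 - A * β ^ 2) * B := by
  let _ := h.divisionRing
  have hAc (z : ℍ[k,a,b]) : coe A * z = z * coe A := coe_commutes A z
  have hA0 : (coe A : ℍ[k,a,b]) ≠ 0 := fun h' => hA (coe_injective (h'.trans coe_zero.symm))
  have hus (c : k) : u ≠ coe c := by
    rintro rfl
    rw [← coe_commutes c, ← sub_eq_zero, sub_neg_eq_add, ← add_mul, ← coe_add] at huj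
    rcases mul_eq_zero.1 huj with h' | h'
    · have hc : 2 * c = 0 := by
        rw [two_mul]; exact coe_injective (h'.trans coe_zero.symm)
      have hc0 := (mul_eq_zero.1 hc).resolve_left h2
      rw [hc0] at hu
      exact hA0 (by rw [← hu]; simp)
    · exact hj0 h'
  -- Explicit Skolem–Noether: `u v + A` intertwines `u` and `v`. It vanishes only if `v = -u`, and
  -- then `j` does the job.
  obtain ⟨e, he0, he⟩ : ∃ e, e ≠ 0 ∧ u * e = e * v := by
    by_cases h0 : u * v + coe A = 0
    · refine ⟨j, hj0, ?_⟩
      have : coe A * (u + v) = 0 := by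
        calc coe A * (u + v) = u * coe A + u * u * v := by rw [hu, mul_add, hAc u]
          _ = u * (u * v + coe A) := by noncomm_ring
          _ = 0 := by rw [h0, mul_zero]
      have huv : v = -u := by
        rw [eq_neg_iff_add_eq_zero, add_comm]
        exact (mul_eq_zero.1 this).resolve_left hA0
      rw [huj, huv, mul_neg]
    · refine ⟨_, h0, ?_⟩
      calc u * (u * v + coe A) = u * u * v + u * coe A := by noncomm_ring
        _ = u * (v * v) + v * coe A := by rw [hu, hv, hAc, add_comm]
        _ = (u * v + coe A) * v := by rw [← hAc v]; noncomm_ring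
  have he' : v * e⁻¹ = e⁻¹ * u := by
    rw [eq_inv_mul_iff_mul_eq₀ he0, ← mul_assoc, ← he, mul_inv_cancel_right₀ he0]
  set w' := e * w * e⁻¹ with hw'
  have huw : u * w' = -(w' * u) := by
    calc u * w' = e * (v * w) * e⁻¹ := by rw [hw', ← mul_assoc, ← mul_assoc, he, mul_assoc e]
      _ = -(e * w * (v * e⁻¹)) := by rw [hvw]; noncomm_ring
      _ = -(w' * u) := by rw [he', hw', mul_assoc _ e⁻¹ u]
  have hww : w' * w' = coe C := by
    calc w' * w' = e * w * (e⁻¹ * e) * w * e⁻¹ := by rw [hw']; noncomm_ring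
      _ = e * (w * w) * e⁻¹ := by rw [inv_mul_cancel₀ he0]; noncomm_ring
      _ = coe C := by rw [hw, ← coe_commutes C e, mul_assoc, mul_inv_cancel₀ he0, mul_one]
  have huj' : u * j⁻¹ = -(j⁻¹ * u) := by
    rw [← mul_neg, eq_inv_mul_iff_mul_eq₀ hj0, ← mul_assoc, ← neg_neg (j * u), ← huj, neg_mul,
      mul_inv_cancel_right₀ hj0]
  have hz : w' * j⁻¹ * u = u * (w' * j⁻¹) := by
    calc w' * j⁻¹ * u = -(w' * -(j⁻¹ * u)) := by noncomm_ring
      _ = -(w' * u) * j⁻¹ := by rw [← huj']; noncomm_ring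
      _ = u * (w' * j⁻¹) := by rw [← huw]; noncomm_ring
  obtain ⟨α, β, hαβ⟩ := exists_eq_add_of_commute h2 h hus hz
  refine ⟨α, β, coe_injective (c₁ := a) (c₂ := 0) (c₃ := b) ?_⟩
  have hwj : w' = (coe α + coe β * u) * j := by
    rw [← hαβ, inv_mul_cancel_right₀ hj0]
  calc coe C = w' * w' := hww.symm
    _ = (coe α + coe β * u) * (j * coe α + j * coe β * u) * j := by
      conv_lhs => rw [hwj]
      noncomm_ring
    _ = (coe α + coe β * u) * (coe α * j - coe β * (u * j)) * j := by
      rw [← coe_commutes α, ← coe_commutes β, huj]; noncomm_ring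
    _ = (coe α * coe α + coe β * (u * coe α) - coe α * coe β * u - coe β * (u * coe β) * u)
        * (j * j) := by noncomm_ring
    _ = (coe α * coe α - coe β * coe β * (u * u)) * (j * j) := by
      have h5 : coe β * (u * coe α) = coe α * coe β * u := by
        rw [← coe_commutes α u, ← mul_assoc, ← coe_mul, ← coe_mul, mul_comm]
      have h6 : coe β * (u * coe β) * u = coe β * coe β * (u * u) := by
        rw [← coe_commutes β u]; simp only [mul_assoc]
      rw [h5, h6, add_sub_cancel_right]
    _ = coe ((α ^ 2 - A * β ^ 2) * B) := by
      rw [hu, hj]; simp only [← coe_mul, ← coe_sub]; congr 1; ring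

end Field

end QuaternionAlgebra

/-! ### The place `X² - a` of `k(X)`, with residue field `k(√a)`. -/

theorem QuadraticAlgebra.X_sq_sub_C_dvd_iff {k : Type*} [Field k] {a : k} {P : k[X]} :
    X ^ 2 - C a ∣ P ↔ aeval (QuadraticAlgebra.omega : QuadraticAlgebra k a 0) P = 0 := by
  have hω : aeval (QuadraticAlgebra.omega : QuadraticAlgebra k a 0) (X ^ 2 - C a) = 0 := by
    simp only [map_sub, map_pow, aeval_X, aeval_C]
    ext <;> simp [pow_two]
  constructor
  · rintro ⟨Q, rfl⟩
    rw [map_mul, hω, zero_mul]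
  · intro h
    have hm : (X ^ 2 - C a).Monic := monic_X_pow_sub_C a two_ne_zero
    have hd := natDegree_modByMonic_lt P hm (by
      intro h1; simpa using congrArg natDegree h1)
    rw [natDegree_X_pow_sub_C] at hd
    have hlin := eq_X_add_C_of_natDegree_le_one (Nat.le_of_lt_succ hd)
    have hP := modByMonic_add_div P (X ^ 2 - C a)
    rw [← hP, map_add, map_mul, hω, zero_mul, add_zero, hlin] at h
    simp only [map_add, map_mul, aeval_X, aeval_C] at h
    have h0 := congrArg QuadraticAlgebra.re h
    have h1 := congrArg QuadraticAlgebra.im h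
    simp at h0 h1
    rw [← modByMonic_eq_zero_iff_dvd hm, hlin, h0, h1]
    simp

/-- `c (X² - a)` is not a norm from `k(X)(√(d a))` if none of `a`, `d`, `d a` is a square. -/
theorem eq_zero_of_norm_eq {k : Type*} [Field k] (h2 : (2 : k) ≠ 0) {a d c : k}
    (ha : ¬ IsSquare a) (hd : ¬ IsSquare d) (had : ¬ IsSquare (d * a)) (hc : c ≠ 0)
    {P Q R : k[X]} (h : P ^ 2 - C (d * a) * Q ^ 2 = C c * (X ^ 2 - C a) * R ^ 2) : R = 0 := by
  have : Fact (∀ r : k, r ^ 2 ≠ a + 0 * r) :=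
    ⟨fun r hr => ha ⟨r, by rw [← pow_two, hr]; ring⟩⟩
  induction hn : R.natDegree using Nat.strong_induction_on generalizing P Q R with
  | _ n ih =>
  by_contra hR
  set f : k[X] →ₐ[k] QuadraticAlgebra k a 0 := aeval QuadraticAlgebra.omega with hf
  have hπ : f (X ^ 2 - C a) = 0 := QuadraticAlgebra.X_sq_sub_C_dvd_iff.1 dvd_rfl
  have hπ0 : (X ^ 2 - C a : k[X]) ≠ 0 := (monic_X_pow_sub_C a two_ne_zero).ne_zero
  have hfe : f P ^ 2 = algebraMap k _ (d * a) * f Q ^ 2 := by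
    have := congrArg f h
    simp only [map_sub, map_mul, map_pow] at this hπ
    rw [hπ, mul_zero, zero_mul, sub_eq_zero] at this
    rw [this, hf, aeval_C, aeval_C, map_mul]
  -- Otherwise `d a` is a square in `k(√a)`. An element of `k` that is such a square has the form
  -- `s²` or `a t²` with `s`, `t` in `k`, so `d a` or `d` would be a square in `k`.
  have hQ : f Q = 0 := by
    by_contra hQ
    have ht : (f P / f Q) ^ 2 = algebraMap k _ (d * a) := by
      rw [div_pow, hfe, mul_div_cancel_right₀ _ (pow_ne_zero 2 hQ)]
    set t := f P / f Q
    have e0 := congrArg QuadraticAlgebra.re ht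
    have e1 := congrArg QuadraticAlgebra.im ht
    simp [pow_two] at e0 e1
    have e2 : 2 * (t.re * t.im) = 0 := by linear_combination e1
    rcases mul_eq_zero.1 ((mul_eq_zero.1 e2).resolve_left h2) with h0 | h0
    · refine hd ⟨t.im, ?_⟩
      have ha0 : a ≠ 0 := by rintro rfl; exact ha (IsSquare.zero)
      apply mul_right_cancel₀ ha0
      rw [h0] at e0
      linear_combination -e0
    · refine had ⟨t.re, ?_⟩
      rw [h0] at e0
      linear_combination -e0
  have hP : f P = 0 := by
    rw [hQ] at hfe; simpa using hfe
  obtain ⟨P', rfl⟩ := QuadraticAlgebra.X_sq_sub_C_dvd_iff.2 hP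
  obtain ⟨Q', rfl⟩ := QuadraticAlgebra.X_sq_sub_C_dvd_iff.2 hQ
  have h' : (X ^ 2 - C a) * (P' ^ 2 - C (d * a) * Q' ^ 2) = C c * R ^ 2 := by
    apply mul_left_cancel₀ hπ0
    linear_combination h
  have hRf : f R = 0 := by
    have := congrArg f h'
    rw [map_mul, hπ, zero_mul, map_mul, map_pow] at this
    rcases mul_eq_zero.1 this.symm with h3 | h3
    · rw [hf, aeval_C] at h3
      exact absurd (QuadraticAlgebra.algebraMap_injective (h3.trans (map_zero _).symm)) hc
    · exact pow_eq_zero_iff two_ne_zero |>.1 h3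
  obtain ⟨R', rfl⟩ := QuadraticAlgebra.X_sq_sub_C_dvd_iff.2 hRf
  have hR' : R' ≠ 0 := right_ne_zero_of_mul hR
  -- Infinite descent: `P`, `Q` and `R` are all divisible by `X² - a`, and the quotients satisfy the
  -- same equation.
  refine hR' (ih R'.natDegree ?_ (P := P') (Q := Q') ?_ rfl)
  · rw [← hn, natDegree_mul hπ0 hR', natDegree_X_pow_sub_C]; omega
  · apply mul_left_cancel₀ hπ0
    linear_combination h'

/-! ### Linear square roots, and isotropy over `k(x)(√δ)`. -/

namespace QuaternionAlgebra

section Linear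

variable {k : Type*} [Field k] {a b : k}

/-- Evaluation of quaternions with polynomial coefficients at a scalar. -/
noncomputable def evalHom (t : k) : ℍ[k[X],C a,C b] →+* ℍ[k,a,b] :=
  map (evalRingHom t) (by simp) (by simp)

theorem evalHom_coe (t : k) (p : k[X]) :
    evalHom t (coe p : ℍ[k[X],C a,C b]) = coe (p.eval t) := map_coe _ _ _ _

/-- By the degree bound the root is linear, `v = v₁ X + v₀`. Evaluating its square at `0`, `1` and
`-1` separates the coefficients. -/
theorem exists_of_mul_self_eq_quadratic (h2 : (2 : k) ≠ 0) (hk : NormAnisotropic k a b) {A B : k}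
    {v : ℍ[k[X],C a,C b]} (hv : v * v = coe (C A * X ^ 2 + C B)) :
    ∃ v₁ v₀ : ℍ[k,a,b], v₁ * v₁ = coe A ∧ v₀ * v₀ = coe B ∧ v₁ * v₀ = -(v₀ * v₁) := by
  have hlin : DegreeLE v 1 := by
    by_cases h0 : v = 0
    · simp [h0, DegreeLE]
    · have hd := (redNorm_ne_zero_and_degreeLE hk h0).2
      have hn : (redNorm v).natDegree ≤ 2 := by
        have h1 := congrArg redNorm hv
        rw [redNorm_mul, redNorm_coe, ← pow_two] at h1
        have h3 : (C A * X ^ 2 + C B : k[X]).natDegree ≤ 2 := by compute_degree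
        rcases sq_eq_sq_iff_eq_or_eq_neg.1 h1 with h | h
        · rwa [h]
        · rwa [h, natDegree_neg]
      have h1 : (redNorm v).natDegree / 2 ≤ 1 := by omega
      exact ⟨hd.1.trans h1, hd.2.1.trans h1, hd.2.2.1.trans h1, hd.2.2.2.trans h1⟩
  obtain ⟨l0, l1, l2, l3⟩ := hlin
  have hev (p : k[X]) (hp : p.natDegree ≤ 1) (t : k) : p.eval t = p.coeff 0 + t * p.coeff 1 := by
    conv_lhs => rw [eq_X_add_C_of_natDegree_le_one hp]
    simp; ring
  have heq (t : k) : evalHom t v = coeffs v 0 + coe t * coeffs v 1 := by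
    ext
    · simpa [evalHom, coeffs] using hev _ l0 t
    · simpa [evalHom, coeffs] using hev _ l1 t
    · simpa [evalHom, coeffs] using hev _ l2 t
    · simpa [evalHom, coeffs] using hev _ l3 t
  have hsq (t : k) : (coeffs v 0 + coe t * coeffs v 1) * (coeffs v 0 + coe t * coeffs v 1)
      = coe (A * t ^ 2 + B) := by
    rw [← heq, ← map_mul, hv, evalHom_coe]; simp
  have s0 := hsq 0
  have s1 := hsq 1
  have s2 := hsq (-1)
  generalize coeffs v 0 = v₀ at *
  generalize coeffs v 1 = v₁ at *
  simp only [coe_zero, zero_mul, add_zero, coe_one, one_mul, coe_neg, neg_mul] at s0 s1 s2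
  have cancel (z : ℍ[k,a,b]) (hz : z + z = 0) : z = 0 := by
    have : (2 : k) • z = 0 := by rw [two_smul, hz]
    exact (smul_eq_zero.1 this).resolve_left h2
  have t0 : v₀ * v₀ = coe B := by simpa using s0
  have t1 : v₁ * v₁ = coe A := by
    rw [← sub_eq_zero]
    apply cancel
    have e1 : v₀ * v₀ + v₀ * v₁ + v₁ * v₀ + v₁ * v₁ = coe A + coe B := by
      rw [← coe_add]; convert s1 using 1
      · noncomm_ring
      · congr 1; ring
    have e2 : v₀ * v₀ - v₀ * v₁ - v₁ * v₀ + v₁ * v₁ = coe A + coe B := by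
      rw [← coe_add]; convert s2 using 1
      · noncomm_ring
      · congr 1; ring
    calc v₁ * v₁ - coe A + (v₁ * v₁ - coe A)
        = (v₀ * v₀ + v₀ * v₁ + v₁ * v₀ + v₁ * v₁) + (v₀ * v₀ - v₀ * v₁ - v₁ * v₀ + v₁ * v₁)
          - v₀ * v₀ - v₀ * v₀ - coe A - coe A := by noncomm_ring
      _ = 0 := by rw [e1, e2, t0]; abel
  refine ⟨v₁, v₀, t1, t0, ?_⟩
  rw [← sub_eq_zero, sub_neg_eq_add]
  have e1 : v₀ * v₀ + v₀ * v₁ + v₁ * v₀ + v₁ * v₁ = coe A + coe B := by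
    rw [← coe_add]; convert s1 using 1
    · noncomm_ring
    · congr 1; ring
  rw [t0, t1] at e1
  calc v₁ * v₀ + v₀ * v₁ = (coe B + v₀ * v₁ + v₁ * v₀ + coe A) - coe A - coe B := by abel
    _ = 0 := by rw [e1]; abel

end Linear

section Denominators

variable {k E : Type*} [Field k] [Field E] [Algebra k E] {a b : k}

/-- `s` is of the form `(p(x) + q(x) w) / r(x)` for polynomials `p, q, r` over `k`. -/
def IsRatio (k : Type*) {E : Type*} [Field k] [Field E] [Algebra k E] (x w s : E) : Prop :=
  ∃ p q r : k[X], aeval x r ≠ 0 ∧ aeval x r * s = aeval x p + w * aeval x q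

/-- Substitution of `x` for the variable in quaternions with polynomial coefficients. -/
noncomputable def aevalHom (x : E) :
    ℍ[k[X],C a,C b] →+* ℍ[E,algebraMap k E a,algebraMap k E b] :=
  map (aeval x : k[X] →ₐ[k] E).toRingHom (aeval_C x a) (aeval_C x b)

theorem redNorm_aevalHom (x : E) (z : ℍ[k[X],C a,C b]) :
    redNorm (aevalHom x z) = aeval x (redNorm z) := redNorm_map _ _ _ _

theorem aevalHom_coe (x : E) (p : k[X]) :
    aevalHom x (coe p : ℍ[k[X],C a,C b]) = coe (aeval x p) := map_coe _ _ _ _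

theorem aevalHom_injective {x : E} (hx : Transcendental k x) :
    Function.Injective (aevalHom x : ℍ[k[X],C a,C b] →+* _) :=
  map_injective _ _ (transcendental_iff_injective.1 hx)

theorem exists_common_denominator {x w : E} {z : ℍ[E,algebraMap k E a,algebraMap k E b]}
    (h0 : IsRatio k x w z.re) (h1 : IsRatio k x w z.imI) (h2 : IsRatio k x w z.imJ)
    (h3 : IsRatio k x w z.imK) :
    ∃ (p q : ℍ[k[X],C a,C b]) (r : k[X]), aeval x r ≠ 0 ∧
      coe (aeval x r) * z = aevalHom x p + coe w * aevalHom x q := by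
  obtain ⟨p0, q0, r0, n0, e0⟩ := h0
  obtain ⟨p1, q1, r1, n1, e1⟩ := h1
  obtain ⟨p2, q2, r2, n2, e2⟩ := h2
  obtain ⟨p3, q3, r3, n3, e3⟩ := h3
  refine ⟨⟨p0 * r1 * r2 * r3, p1 * r0 * r2 * r3, p2 * r0 * r1 * r3, p3 * r0 * r1 * r2⟩,
    ⟨q0 * r1 * r2 * r3, q1 * r0 * r2 * r3, q2 * r0 * r1 * r3, q3 * r0 * r1 * r2⟩,
    r0 * r1 * r2 * r3, by simp [n0, n1, n2, n3], ?_⟩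
  ext
  · simp [aevalHom]
    linear_combination aeval x r1 * aeval x r2 * aeval x r3 * e0
  · simp [aevalHom]
    linear_combination aeval x r0 * aeval x r2 * aeval x r3 * e1
  · simp [aevalHom]
    linear_combination aeval x r0 * aeval x r1 * aeval x r3 * e2
  · simp [aevalHom]
    linear_combination aeval x r0 * aeval x r1 * aeval x r2 * e3

theorem eq_zero_of_redNorm_eq_zero_of_isRatio (hk : NormAnisotropic k a b) {x : E}
    (hx : Transcendental k x) {z : ℍ[E,algebraMap k E a,algebraMap k E b]}
    (h0 : IsRatio k x 0 z.re) (h1 : IsRatio k x 0 z.imI) (h2 : IsRatio k x 0 z.imJ)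
    (h3 : IsRatio k x 0 z.imK) (hz : redNorm z = 0) : z = 0 := by
  obtain ⟨p, q, r, hr, e⟩ := exists_common_denominator h0 h1 h2 h3
  rw [coe_zero, zero_mul, add_zero] at e
  have h := congrArg redNorm e
  rw [redNorm_mul, hz, mul_zero, redNorm_aevalHom] at h
  have hp : p = 0 := hk.polynomial _
    (transcendental_iff_injective.1 hx (h.symm.trans (map_zero _).symm))
  rw [hp, map_zero, coe_mul_eq_smul] at e
  exact (smul_eq_zero.1 e).resolve_left hr

/-- If the norm form becomes isotropic over `k(x)(√δ)`, then `δ` is a square in the quaternion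
algebra over `k(x)`. -/
theorem exists_mul_self_eq_of_isotropic (hchar : (2 : k) ≠ 0) (hk : NormAnisotropic k a b) {x w : E}
    (hx : Transcendental k x) {δ : k[X]} (hw : w * w = aeval x δ)
    {z : ℍ[E,algebraMap k E a,algebraMap k E b]}
    (h0 : IsRatio k x w z.re) (h1 : IsRatio k x w z.imI) (h2 : IsRatio k x w z.imJ)
    (h3 : IsRatio k x w z.imK) (hz : redNorm z = 0) (hz0 : z ≠ 0) :
    ∃ (P : ℍ[k[X],C a,C b]) (g : k[X]), g ≠ 0 ∧ P * P = coe (δ * g ^ 2) := by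
  have hinj := transcendental_iff_injective.1 hx
  obtain ⟨p, q, r, hr, e⟩ := exists_common_denominator h0 h1 h2 h3
  have hN := congrArg redNorm e
  rw [redNorm_mul, hz, mul_zero] at hN
  -- `2 T` is the polar form of the norm at `p`, `q`, that is, the coefficient of `w` in the norm of
  -- `p + w q`.
  set T : k[X] := (p * star q).re with hT
  have hexp : aeval x (redNorm p + δ * redNorm q) + w * aeval x (2 * T) = 0 := by
    rw [hN, hT, map_add, map_mul, map_mul _ 2, map_ofNat, ← hw]
    simp [redNorm, aevalHom]
    ring
  -- If `T = 0`, then `p * star q` is pure with square `-N(p) N(q) = δ N(q)²`. If not, `w` itself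
  -- lies in `k(x)`, and `δ` is already the square of a scalar.
  by_cases hT0 : T = 0
  · have hpq : redNorm p + δ * redNorm q = 0 := by
      rw [hT0] at hexp
      apply hinj
      simpa using hexp
    refine ⟨p * star q, redNorm q, ?_, ?_⟩
    · intro hq
      rw [hq, mul_zero, add_zero] at hpq
      rw [hk.polynomial _ hq, hk.polynomial _ hpq, map_zero, mul_zero, add_zero,
        coe_mul_eq_smul] at e
      exact hz0 ((smul_eq_zero.1 e).resolve_left hr)
    · rw [mul_self_of_re_eq_zero hT0, redNorm_mul, redNorm_star]
      congr 1
      linear_combination -redNorm q * hpq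
  · have h2T : (2 * T : k[X]) ≠ 0 := by
      refine mul_ne_zero ?_ hT0
      rw [← C_ofNat]
      exact C_ne_zero.2 hchar
    refine ⟨coe (redNorm p + δ * redNorm q), 2 * T, h2T, ?_⟩
    rw [← coe_mul]
    congr 1
    apply hinj
    have h5 : aeval x (redNorm p + δ * redNorm q) = -(w * aeval x (2 * T)) :=
      eq_neg_of_add_eq_zero_left hexp
    rw [map_mul, h5, map_mul _ δ, map_pow, ← hw]
    ring

end Denominators

end QuaternionAlgebra

/-! ### Division algebras stay division over the function field of the quadric. -/

namespace QuaternionAlgebra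

/-- Let `K = k(y)` be a rational function field, and let `w² = d (a x² + b (y² - a))` with `x`
transcendental over `K`. A quaternion division algebra over `k` stays a division algebra over
`K(x, w)`, provided that `a` and `d` are not squares. -/
theorem eq_zero_of_redNorm_eq_zero_of_quadric {k K E : Type*} [Field k] [Field K] [Field E]
    [Algebra k K] [Algebra K E] (hchar : (2 : k) ≠ 0) {a b d a' b' : k} (ha : ¬ IsSquare a)
    (hb : b ≠ 0) (hd : ¬ IsSquare d) (hk : NormAnisotropic k a' b') {y : K}
    (hy : Transcendental k y) (hK : ∀ s : K, IsRatio k y 0 s) {x w : E} (hx : Transcendental K x)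
    (hw : w * w = algebraMap K E (algebraMap k K d) * (algebraMap K E (algebraMap k K a) * x ^ 2 +
      algebraMap K E (algebraMap k K b) * (algebraMap K E y ^ 2 - algebraMap K E (algebraMap k K a))))
    {z : ℍ[E,algebraMap K E (algebraMap k K a'),algebraMap K E (algebraMap k K b')]}
    (h0 : IsRatio K x w z.re) (h1 : IsRatio K x w z.imI) (h2 : IsRatio K x w z.imJ)
    (h3 : IsRatio K x w z.imK) (hz : redNorm z = 0) : z = 0 := by
  by_contra hz0
  have ha0 : a ≠ 0 := by rintro rfl; exact ha IsSquare.zero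
  have hd0 : d ≠ 0 := by rintro rfl; exact hd IsSquare.zero
  have hda0 : d * a ≠ 0 := mul_ne_zero hd0 ha0
  have hinj := transcendental_iff_injective.1 hy
  have hφ := (algebraMap k K).injective
  have hcharK : (2 : K) ≠ 0 := by
    intro h; apply hchar; apply hφ; rw [map_ofNat, h, map_zero]
  have hKK : NormAnisotropic K (algebraMap k K a') (algebraMap k K b') := fun z hz =>
    eq_zero_of_redNorm_eq_zero_of_isRatio hk hy (hK _) (hK _) (hK _) (hK _) hz
  have hB0 : algebraMap k K (d * b) * (y ^ 2 - algebraMap k K a) ≠ 0 := by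
    refine mul_ne_zero ?_ fun h => ?_
    · exact (_root_.map_ne_zero _).2 (mul_ne_zero hd0 hb)
    · refine (monic_X_pow_sub_C a two_ne_zero).ne_zero (hinj ?_)
      simpa using h
  obtain ⟨P, g, hg, hP⟩ := exists_mul_self_eq_of_isotropic hcharK hKK hx
    (δ := C (algebraMap k K (d * a)) * X ^ 2 +
      C (algebraMap k K (d * b) * (y ^ 2 - algebraMap k K a)))
    (by rw [hw]; simp; ring) h0 h1 h2 h3 hz hz0
  obtain ⟨v, hv⟩ := exists_mul_self_eq hKK hg hP
  obtain ⟨v₁, v₀, hv₁, hv₀, hv₁₀⟩ := exists_of_mul_self_eq_quadratic hcharK hKK hv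
  obtain ⟨p, _, r, hr, hpr⟩ :=
    exists_common_denominator (hK v₁.re) (hK v₁.imI) (hK v₁.imJ) (hK v₁.imK)
  rw [coe_zero, zero_mul, add_zero] at hpr
  have hpp : p * p = coe (C (d * a) * r ^ 2) := by
    apply aevalHom_injective hy
    rw [map_mul, ← hpr, aevalHom_coe, mul_assoc, ← mul_assoc v₁, ← coe_commutes _ v₁, mul_assoc,
      hv₁]
    simp only [← coe_mul]
    congr 1
    simp; ring
  have hr0 : r ≠ 0 := by rintro rfl; simp at hr
  obtain ⟨v', hv'⟩ := exists_mul_self_eq hk hr0 hpp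
  -- `v'` squares to a constant, so specializing the variable yields a root over `k`.
  obtain ⟨u, hu⟩ : ∃ u : ℍ[k,a',b'], u * u = coe (d * a) :=
    ⟨evalHom 0 v', by rw [← map_mul, hv', evalHom_coe, eval_C]⟩
  have hv₀0 : v₀ ≠ 0 := by
    rintro rfl
    rw [zero_mul] at hv₀
    exact hB0 (coe_injective (hv₀.symm.trans coe_zero.symm))
  -- If `d a = c²`, then `v₁ = ±c` is central; anticommuting with `v₀ ≠ 0` forces `v₁ = 0`, against
  -- `d a ≠ 0`.
  have hnsq : ¬ IsSquare (d * a) := by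
    rintro ⟨c, hc⟩
    have hfac : (v₁ - coe (algebraMap k K c)) * (v₁ + coe (algebraMap k K c)) = 0 := by
      calc _ = v₁ * v₁ + v₁ * coe (algebraMap k K c) - coe (algebraMap k K c) * v₁
            - coe (algebraMap k K c) * coe (algebraMap k K c) := by noncomm_ring
        _ = 0 := by
          rw [coe_commutes, add_sub_cancel_right, hv₁, ← coe_mul, hc, map_mul, sub_self]
    have hscal : ∃ c' : K, v₁ = coe c' := by
      rcases hKK.mul_eq_zero hfac with h | h
      · exact ⟨_, sub_eq_zero.1 h⟩
      · exact ⟨-algebraMap k K c, by rw [coe_neg]; exact eq_neg_of_add_eq_zero_left h⟩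
    obtain ⟨c', rfl⟩ := hscal
    rw [← coe_commutes, ← sub_eq_zero, sub_neg_eq_add, ← add_mul, ← coe_add, coe_mul_eq_smul,
      ← two_mul] at hv₁₀
    have hc' := (mul_eq_zero.1 ((smul_eq_zero.1 hv₁₀).resolve_right hv₀0)).resolve_left hcharK
    rw [hc', coe_zero, zero_mul] at hv₁
    exact hda0 (hφ (by rw [map_zero]; exact coe_injective (hv₁.symm.trans coe_zero.symm)))
  have hus (c : k) : u ≠ coe c := by
    rintro rfl
    rw [← coe_mul] at hu
    exact hnsq ⟨c, (coe_injective hu).symm⟩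
  obtain ⟨j, B, hj0, hj, huj⟩ := exists_anticommute hchar hk hus hu
  have hB : B ≠ 0 := by
    rintro rfl
    rw [coe_zero] at hj
    rcases hk.mul_eq_zero hj with h | h <;> exact hj0 h
  let φ : ℍ[k,a',b'] →+* ℍ[K,algebraMap k K a',algebraMap k K b'] := map (algebraMap k K) rfl rfl
  -- Compare two presentations over `k(y)`: the constant pair `u`, `j` and the pair `v₁`, `v₀`.
  obtain ⟨α, β, hαβ⟩ := exists_norm_ratio hcharK hKK (u := φ u) (j := φ j)
    (B := algebraMap k K B) ((_root_.map_ne_zero _).2 hda0)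
    (by rw [← map_mul, hu]; exact map_coe _ _ _ _) hv₁
    (by rw [← map_mul, hj]; exact map_coe _ _ _ _) hv₀
    (by rw [← map_mul, huj, map_neg, map_mul]) hv₁₀
    (fun h => hj0 (map_injective _ _ hφ (h.trans (map_zero φ).symm)))
  obtain ⟨p₁, _, r₁, hr₁, e₁⟩ := hK α
  obtain ⟨p₂, _, r₂, hr₂, e₂⟩ := hK β
  rw [zero_mul, add_zero] at e₁ e₂
  have hfin : (p₁ * r₂) ^ 2 - C (d * a) * (p₂ * r₁) ^ 2 =
      C (d * b / B) * (X ^ 2 - C a) * (r₁ * r₂) ^ 2 := by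
    apply hinj
    simp only [map_sub, map_mul, map_pow, aeval_C, aeval_X, map_div₀] at hαβ ⊢
    have hB' := (_root_.map_ne_zero (algebraMap k K)).2 hB
    rw [← e₁, ← e₂]
    field_simp
    linear_combination -hαβ
  have := eq_zero_of_norm_eq hchar ha hd hnsq (div_ne_zero (mul_ne_zero hd0 hb) hB) hfin
  rcases mul_eq_zero.1 this with rfl | rfl
  · simp at hr₁
  · simp at hr₂

end QuaternionAlgebra

/-! ### Countable subfields of `ℂ` and closing off. -/

/-- A countable closing-off argument for subfields of `ℂ`: if every single requirement can be met
in a larger good subfield, then all of them can be met at once. -/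
theorem Subfield.exists_closed_under {Good : Subfield ℂ → Prop}
    (hunion : ∀ f : ℕ → Subfield ℂ, Monotone f → (∀ n, Good (f n)) → Good (⨆ n, f n))
    (hcount : ∀ F, Good F → Countable F) {Sol : ℕ → ℂ → Subfield ℂ → Prop}
    (hmono : ∀ i d F F', F ≤ F' → Sol i d F → Sol i d F')
    (hstep : ∀ F, Good F → ∀ i, ∀ d ∈ F, ∃ F', F ≤ F' ∧ Good F' ∧ Sol i d F')
    {F₀ : Subfield ℂ} (h₀ : Good F₀) :
    ∃ F, F₀ ≤ F ∧ Good F ∧ ∀ i, ∀ d ∈ F, Sol i d F := by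
  have level : ∀ F, Good F → ∃ F', F ≤ F' ∧ Good F' ∧ ∀ i, ∀ d ∈ F, Sol i d F' := by
    intro F hF
    have := hcount F hF
    obtain ⟨e, he⟩ := exists_surjective_nat (ℕ × F)
    -- Recording `F ≤ F'` keeps each enumerated `d` of `F` inside every later stage.
    let G := {F' // Good F' ∧ F ≤ F'}
    have hs : ∀ (n : ℕ) (H : G), ∃ H' : G, H.1 ≤ H'.1 ∧ Sol (e n).1 (e n).2 H'.1 := by
      intro n H
      obtain ⟨F', h1, h2, h3⟩ := hstep H.1 H.2.1 (e n).1 (e n).2 (H.2.2 (e n).2.2)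
      exact ⟨⟨F', h2, H.2.2.trans h1⟩, h1, h3⟩
    choose s hs1 hs2 using hs
    let g : ℕ → G := Nat.rec ⟨F, hF, le_rfl⟩ s
    have hg : Monotone fun n => (g n).1 := monotone_nat_of_le_succ fun n => hs1 n (g n)
    refine ⟨⨆ n, (g n).1, le_iSup (fun n => (g n).1) 0, hunion _ hg fun n => (g n).2.1, ?_⟩
    intro i d hd
    obtain ⟨n, hn⟩ := he (i, ⟨d, hd⟩)
    have h4 := hs2 n (g n)
    rw [hn] at h4
    exact hmono _ _ _ _ (le_iSup (fun n => (g n).1) (n + 1)) h4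
  -- One level only serves elements of the field it started from; iterating and taking the union
  -- also serves the elements added on the way.
  choose! s hs1 hs2 hs3 using level
  let g : ℕ → Subfield ℂ := Nat.rec F₀ fun _ => s
  have hgood : ∀ n, Good (g n) := by
    intro n
    induction n with
    | zero => exact h₀
    | succ n ih => exact hs2 _ ih
  have hg : Monotone g := monotone_nat_of_le_succ fun n => hs1 _ (hgood n)
  refine ⟨⨆ n, g n, le_iSup g 0, hunion _ hg hgood, ?_⟩
  intro i d hd
  obtain ⟨n, hn⟩ := (Subfield.mem_iSup_of_directed hg.directed_le).1 hd
  exact hmono _ _ _ _ (le_iSup g (n + 1)) (hs3 _ (hgood n) i d hn)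

theorem IntermediateField.countable_adjoin_simple {F E : Type*} [Field F] [Field E] [Algebra F E]
    [Countable F] (x : E) : Countable F⟮x⟯ := by
  rw [← Cardinal.mk_le_aleph0_iff, ← Cardinal.lift_le_aleph0]
  refine (IntermediateField.lift_cardinalMk_adjoin_le F {x}).trans ?_
  simp

theorem exists_transcendental_of_countable (F : Type*) [Field F] [Algebra F ℂ] [Countable F] :
    ∃ x : ℂ, Transcendental F x := by
  by_contra! h
  have hc := Algebraic.countable F ℂ
  have : {x : ℂ | IsAlgebraic F x} = Set.univ := by
    ext x
    simpa [Transcendental] using h x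
  rw [this] at hc
  exact not_countable_complex hc

/-! ### Adjoining a generic point of the quadric inside `ℂ`. -/

namespace QuaternionAlgebra

theorem isRatio_of_mem_adjoin_simple {k E : Type*} [Field k] [Field E] [Algebra k E] {x s : E}
    (w : E) (hs : s ∈ k⟮x⟯) : IsRatio k x w s := by
  obtain ⟨p, r, rfl⟩ := (IntermediateField.mem_adjoin_simple_iff k s).1 hs
  -- A vanishing denominator makes the quotient the default value `0`.
  by_cases h : aeval x r = 0
  · exact ⟨0, 0, 1, by simp, by simp [h]⟩
  · exact ⟨p, 0, r, h, by rw [mul_div_cancel₀ _ h]; simp⟩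

theorem isRatio_of_mem_adjoin_sqrt {k E : Type*} [Field k] [Field E] [Algebra k E] {x w s : E}
    (hw : w * w ∈ k⟮x⟯) (hs : s ∈ k⟮x⟯⟮w⟯) : IsRatio k x w s := by
  set δ : k⟮x⟯ := ⟨w * w, hw⟩ with hδ
  have hm : (X ^ 2 - C δ).Monic := monic_X_pow_sub_C δ two_ne_zero
  have hroot : aeval w (X ^ 2 - C δ) = 0 := by
    simp [hδ, pow_two]
  have hwint : IsIntegral k⟮x⟯ w := ⟨_, hm, hroot⟩
  rw [← IntermediateField.mem_toSubalgebra,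
    IntermediateField.adjoin_simple_toSubalgebra_of_isAlgebraic hwint.isAlgebraic,
    Algebra.adjoin_singleton_eq_range_aeval] at hs
  obtain ⟨f, rfl⟩ := hs
  have hd := natDegree_modByMonic_lt f hm (by
      intro h1; simpa using congrArg natDegree h1)
  rw [natDegree_X_pow_sub_C] at hd
  have hlin := eq_X_add_C_of_natDegree_le_one (Nat.le_of_lt_succ hd)
  have hf : aeval w f = aeval w (f %ₘ (X ^ 2 - C δ)) := by
    conv_lhs => rw [← modByMonic_add_div f (X ^ 2 - C δ)]
    rw [map_add, map_mul, hroot, zero_mul, add_zero]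
  set c₁ := (f %ₘ (X ^ 2 - C δ)).coeff 1
  set c₀ := (f %ₘ (X ^ 2 - C δ)).coeff 0
  obtain ⟨p₀, q₀, r₀, h₀, e₀⟩ := isRatio_of_mem_adjoin_simple (k := k) 0 c₀.2
  obtain ⟨p₁, q₁, r₁, h₁, e₁⟩ := isRatio_of_mem_adjoin_simple (k := k) 0 c₁.2
  refine ⟨p₀ * r₁, p₁ * r₀, r₀ * r₁, by simp [h₀, h₁], ?_⟩
  change _ * aeval w f = _
  rw [hf, hlin]
  have v₀ : algebraMap k⟮x⟯ E c₀ = c₀ := rfl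
  have v₁ : algebraMap k⟮x⟯ E c₁ = c₁ := rfl
  simp only [map_add, map_mul, aeval_C, aeval_X, v₀, v₁]
  linear_combination aeval x r₁ * e₀ + aeval x r₀ * w * e₁

/-- The norm form of `(a, b)` has no nontrivial zero with coordinates in `F`. -/
def AnisotropicOver (F : Subfield ℂ) (a b : ℂ) : Prop :=
  ∀ z : ℍ[ℂ,a,b], z.re ∈ F → z.imI ∈ F → z.imJ ∈ F → z.imK ∈ F → redNorm z = 0 → z = 0

theorem AnisotropicOver.normAnisotropic {F : Subfield ℂ} {a b : F}
    (h : AnisotropicOver F a b) : NormAnisotropic F a b := by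
  intro z hz
  apply map_injective (f := F.subtype) (a' := (a : ℂ)) (b' := (b : ℂ)) rfl rfl F.subtype_injective
  rw [map_zero]
  exact h _ z.re.2 z.imI.2 z.imJ.2 z.imK.2 ((redNorm_map _ _ _ _).trans (by rw [hz, map_zero]))

/-- `d` is the square of a pure quaternion of `(a, b)` with coordinates in `F`. -/
def PureRepresents (F : Subfield ℂ) (a b d : ℂ) : Prop :=
  ∃ x ∈ F, ∃ y ∈ F, ∃ z ∈ F, a * x ^ 2 + b * y ^ 2 - a * b * z ^ 2 = d

theorem exists_extension_pureRepresents {F : Subfield ℂ} (hF : Countable F) {T : Set (ℂ × ℂ)}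
    (hT : ∀ c ∈ T, c.1 ∈ F ∧ c.2 ∈ F ∧ AnisotropicOver F c.1 c.2) {a b d : ℂ} (haF : a ∈ F)
    (hbF : b ∈ F) (hdF : d ∈ F) (ha : ∀ c ∈ F, c * c ≠ a) (hb : b ≠ 0) (hd : ∀ c ∈ F, c * c ≠ d) :
    ∃ F', F ≤ F' ∧ Countable F' ∧ (∀ c ∈ T, AnisotropicOver F' c.1 c.2) ∧
      PureRepresents F' a b d := by
  obtain ⟨y, hy⟩ := exists_transcendental_of_countable F
  let K := F⟮y⟯
  have hKc : Countable K := IntermediateField.countable_adjoin_simple y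
  obtain ⟨x, hx⟩ := exists_transcendental_of_countable K
  obtain ⟨w, hw⟩ := IsAlgClosed.exists_eq_mul_self (d * (a * x ^ 2 + b * (y ^ 2 - a)))
  let L := K⟮x⟯
  have hLc : Countable L := IntermediateField.countable_adjoin_simple x
  let M := L⟮w⟯
  have hMc : Countable M := IntermediateField.countable_adjoin_simple w
  have hFK : ∀ s ∈ F, s ∈ K := fun s hs => K.algebraMap_mem ⟨s, hs⟩
  have hKL : ∀ s ∈ K, s ∈ L := fun s hs => L.algebraMap_mem ⟨s, hs⟩
  have hLM : ∀ s ∈ L, s ∈ M := fun s hs => M.algebraMap_mem ⟨s, hs⟩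
  have hFL : ∀ s ∈ F, s ∈ L := fun s hs => hKL s (hFK s hs)
  have hFM : ∀ s ∈ F, s ∈ M := fun s hs => hLM s (hFL s hs)
  have hyK : y ∈ K := IntermediateField.mem_adjoin_simple_self F y
  have hxL : x ∈ L := IntermediateField.mem_adjoin_simple_self K x
  have hwM : w ∈ M := IntermediateField.mem_adjoin_simple_self L w
  have hwL : w * w ∈ L := by
    rw [← hw]
    exact mul_mem (hFL d hdF) (add_mem (mul_mem (hFL a haF) (pow_mem hxL 2))
      (mul_mem (hFL b hbF) (sub_mem (pow_mem (hKL y hyK) 2) (hFL a haF))))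
  have hd0 : d ≠ 0 := by
    rintro rfl; exact hd 0 F.zero_mem (by simp)
  have ha0 : a ≠ 0 := by
    rintro rfl; exact ha 0 F.zero_mem (by simp)
  refine ⟨M.toSubfield, hFM, hMc, ?_, ?_⟩
  · rintro ⟨a', b'⟩ hc z z0 z1 z2 z3 hz
    obtain ⟨ha'F, hb'F, han⟩ := hT _ hc
    have hsq (c : ℂ) (hcF : c ∈ F) (h : ∀ t ∈ F, t * t ≠ c) : ¬ IsSquare (⟨c, hcF⟩ : F) := by
      rintro ⟨t, ht⟩
      exact h t t.2 (congrArg Subtype.val ht).symm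
    refine eq_zero_of_redNorm_eq_zero_of_quadric (k := F) (K := K) (E := ℂ) (a := ⟨a, haF⟩)
      (b := ⟨b, hbF⟩) (d := ⟨d, hdF⟩) (a' := ⟨a', ha'F⟩) (b' := ⟨b', hb'F⟩) (y := ⟨y, hyK⟩)
      (x := x) (w := w) two_ne_zero (hsq a haF ha) ?_ (hsq d hdF hd)
      (AnisotropicOver.normAnisotropic han) ?_ ?_ hx hw.symm
      (isRatio_of_mem_adjoin_sqrt hwL z0) (isRatio_of_mem_adjoin_sqrt hwL z1)
      (isRatio_of_mem_adjoin_sqrt hwL z2) (isRatio_of_mem_adjoin_sqrt hwL z3) hz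
    · exact fun h => hb (congrArg Subtype.val h)
    · exact (transcendental_algebraMap_iff (S := K) (A := ℂ)
        (FaithfulSMul.algebraMap_injective K ℂ)).1 hy
    · rintro ⟨s, hs⟩
      obtain ⟨p, q, r, hr, e⟩ := isRatio_of_mem_adjoin_simple (k := F) 0 hs
      have hv (g : F[X]) : ((aeval (⟨y, hyK⟩ : K) g : K) : ℂ) = aeval y g :=
        (aeval_algebraMap_apply ℂ (⟨y, hyK⟩ : K) g).symm
      refine ⟨p, q, r, fun h => hr ?_, Subtype.ext ?_⟩
      · rw [← hv, h]; rfl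
      · rw [← hv, ← hv, ← hv] at e
        exact e
  · have hq : a * x ^ 2 + b * (y ^ 2 - a) ≠ 0 := by
      intro h
      refine hx ⟨C ⟨a, hFK a haF⟩ * X ^ 2 + C (⟨b, hFK b hbF⟩ * (⟨y, hyK⟩ ^ 2 - ⟨a, hFK a haF⟩)),
        fun h0 => ?_, ?_⟩
      · have := congrArg (fun p => coeff p 2) h0
        simp at this
        exact ha0 (congrArg Subtype.val this)
      · simp only [map_add, map_mul, aeval_C, aeval_X, map_pow]
        exact h
    have hw0 : w ≠ 0 := by
      rintro rfl
      rw [mul_zero] at hw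
      exact mul_ne_zero hd0 hq hw
    have ht : d / w ∈ M := div_mem (hFM d hdF) hwM
    -- The vector `(x, y, 1)` has value `w² / d` under the form `a X² + b Y² - a b Z²`; scaling by
    -- `d / w` turns this into `d`.
    refine ⟨x * (d / w), mul_mem (hLM x hxL) ht, y * (d / w), mul_mem (hLM y (hKL y hyK)) ht,
      d / w, ht, ?_⟩
    field_simp
    linear_combination hw

end QuaternionAlgebra

/-! ### The base family over `ℚ` and the construction of `K`. -/

theorem even_padicValRat_sq_add_sq {q : ℕ} [hq : Fact q.Prime] (hq4 : q % 4 = 3) {x y : ℚ}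
    (h : x ^ 2 + y ^ 2 ≠ 0) : Even (padicValRat q (x ^ 2 + y ^ 2)) := by
  set m : ℕ := (x.num * y.den).natAbs
  set n : ℕ := (y.num * x.den).natAbs
  set D : ℕ := x.den * y.den
  have hx : (x.den : ℚ) ≠ 0 := by exact_mod_cast x.den_ne_zero
  have hy : (y.den : ℚ) ≠ 0 := by exact_mod_cast y.den_ne_zero
  have hD : (D : ℚ) ≠ 0 := by simp [D]
  have hmn : (x ^ 2 + y ^ 2) * (D : ℚ) ^ 2 = ((m ^ 2 + n ^ 2 : ℕ) : ℚ) := by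
    have hm : (m : ℚ) ^ 2 = (x.num * y.den) ^ 2 := by
      have : ((m : ℤ)) ^ 2 = (x.num * y.den) ^ 2 := Int.natAbs_sq _
      exact_mod_cast this
    have hn : (n : ℚ) ^ 2 = (y.num * x.den) ^ 2 := by
      have : ((n : ℤ)) ^ 2 = (y.num * x.den) ^ 2 := Int.natAbs_sq _
      exact_mod_cast this
    push_cast
    rw [hm, hn]
    have ex : x * x.den = x.num := Rat.mul_den_eq_num x
    have ey : y * y.den = y.num := Rat.mul_den_eq_num y
    rw [← ex, ← ey]
    simp only [D]; push_cast; ring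
  have hval := congrArg (padicValRat q) hmn
  rw [padicValRat.mul h (pow_ne_zero 2 hD), padicValRat.pow, padicValRat.of_nat] at hval
  have hne : m ^ 2 + n ^ 2 ≠ 0 := by
    intro h0
    rw [h0] at hmn
    exact mul_ne_zero h (pow_ne_zero 2 hD) (by simpa using hmn)
  have heven : Even (padicValNat q (m ^ 2 + n ^ 2)) := by
    by_cases hd : q ∣ m ^ 2 + n ^ 2
    · exact Nat.eq_sq_add_sq_iff.1 ⟨m, n, rfl⟩ q
        (Nat.mem_primeFactors.2 ⟨hq.out, hd, hne⟩) hq4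
    · rw [padicValNat.eq_zero_of_not_dvd hd]; exact Even.zero
  obtain ⟨c, hc⟩ := heven
  rw [padicValRat.of_nat, hc] at hval
  refine ⟨c - padicValRat q D, ?_⟩
  push_cast at hval
  linarith

namespace QuaternionAlgebra

/-- An isotropic vector gives `x² + y² = n (z² + w²)`; unless both sides vanish, the valuation at
`q` is even on the left and odd on the right. -/
theorem anisotropicOver_rat {q n : ℕ} [Fact q.Prime] (hq4 : q % 4 = 3)
    (hn : Odd (padicValNat q n)) :
    AnisotropicOver (algebraMap ℚ ℂ).fieldRange (-1) n := by
  rintro ⟨_, _, _, _⟩ ⟨x, rfl⟩ ⟨y, rfl⟩ ⟨z, rfl⟩ ⟨w, rfl⟩ h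
  have hn0 : n ≠ 0 := by
    rintro rfl; simp at hn
  have h' : x ^ 2 + y ^ 2 = n * (z ^ 2 + w ^ 2) := by
    simp [redNorm] at h
    have : (x : ℂ) ^ 2 + (y : ℂ) ^ 2 = n * ((z : ℂ) ^ 2 + (w : ℂ) ^ 2) := by linear_combination h
    exact_mod_cast this
  have hzw : z ^ 2 + w ^ 2 = 0 := by
    by_contra h0
    have hnq : (n : ℚ) ≠ 0 := by exact_mod_cast hn0
    have h1 : x ^ 2 + y ^ 2 ≠ 0 := by rw [h']; exact mul_ne_zero hnq h0
    have e1 := even_padicValRat_sq_add_sq hq4 h1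
    rw [h', padicValRat.mul hnq h0, padicValRat.of_nat] at e1
    have e2 := even_padicValRat_sq_add_sq hq4 h0
    have e3 : Odd (padicValNat q n : ℤ) := by exact_mod_cast hn
    exact (Int.not_even_iff_odd.2 (e3.add_even e2)) e1
  rw [hzw, mul_zero] at h'
  have hz : z = 0 := by nlinarith [sq_nonneg z, sq_nonneg w]
  have hw : w = 0 := by nlinarith [sq_nonneg z, sq_nonneg w]
  have hx : x = 0 := by nlinarith [sq_nonneg x, sq_nonneg y]
  have hy : y = 0 := by nlinarith [sq_nonneg x, sq_nonneg y]
  ext <;> simp [hx, hy, hz, hw]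

theorem AnisotropicOver.iSup {f : ℕ → Subfield ℂ} (hf : Monotone f) {a b : ℂ}
    (h : ∀ n, AnisotropicOver (f n) a b) : AnisotropicOver (⨆ n, f n) a b := by
  intro z h0 h1 h2 h3 hz
  rw [Subfield.mem_iSup_of_directed hf.directed_le] at h0 h1 h2 h3
  obtain ⟨n0, h0⟩ := h0
  obtain ⟨n1, h1⟩ := h1
  obtain ⟨n2, h2⟩ := h2
  obtain ⟨n3, h3⟩ := h3
  exact h (max (max n0 n1) (max n2 n3)) z (hf (by simp) h0) (hf (by simp) h1) (hf (by simp) h2)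
    (hf (by simp) h3) hz

theorem exists_primes_three_mod_four :
    ∃ p : ℕ → ℕ, Function.Injective p ∧ ∀ s, (p s).Prime ∧ p s % 4 = 3 := by
  have hinf : {q : ℕ | q.Prime ∧ (q : ZMod 4) = 3}.Infinite :=
    Nat.infinite_setOfPred_prime_and_eq_mod (by decide)
  refine ⟨fun s => hinf.natEmbedding _ s, fun s t h => (hinf.natEmbedding _).injective
    (Subtype.ext h), fun s => ?_⟩
  obtain ⟨h1, h2⟩ := (hinf.natEmbedding _ s).2
  refine ⟨h1, ?_⟩
  have h3 := (ZMod.natCast_eq_natCast_iff _ 3 4).1 (by exact_mod_cast h2)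
  exact h3

/-- There is a field with infinitely many quaternion division algebras `(a, b s)`, pairwise
distinct in the Brauer group, each of which contains all quadratic extensions of the field. -/
theorem exists_field_family :
    ∃ (K : Subfield ℂ) (b : ℕ → K), (∀ s, NormAnisotropic K (-1) (b s)) ∧
      (∀ s t, s ≠ t → NormAnisotropic K (-1) (b s * b t)) ∧
      ∀ s d, IsSquare d ∨ ∃ x y z : K, -1 * x ^ 2 + b s * y ^ 2 - -1 * b s * z ^ 2 = d := by
  obtain ⟨p, hinj, hp⟩ := exists_primes_three_mod_four
  -- The products `p s * p t` are carried along because their anisotropy is what later keeps the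
  -- algebras non-isomorphic.
  let T : Set ℕ := {n | (∃ s, n = p s) ∨ ∃ s t, s ≠ t ∧ n = p s * p t}
  let Good : Subfield ℂ → Prop := fun F => Countable F ∧ ∀ n ∈ T, AnisotropicOver F (-1) n
  have h₀ : Good (algebraMap ℚ ℂ).fieldRange := by
    refine ⟨(algebraMap ℚ ℂ).rangeRestrictField_bijective.surjective.countable, ?_⟩
    rintro n (⟨s, rfl⟩ | ⟨s, t, hst, rfl⟩)
    · have : Fact (p s).Prime := ⟨(hp s).1⟩
      exact anisotropicOver_rat (hp s).2 (by simp)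
    · have : Fact (p s).Prime := ⟨(hp s).1⟩
      refine anisotropicOver_rat (hp s).2 ?_
      rw [padicValNat.mul (hp s).1.ne_zero (hp t).1.ne_zero, padicValNat.self (hp s).1.one_lt,
        padicValNat_primes (hq := ⟨(hp t).1⟩) (fun h => hst (hinj h))]
      simp
  obtain ⟨K, -, hK, hsol⟩ := Subfield.exists_closed_under (Good := Good)
    -- The alternative "square" is needed for persistence: a nonsquare at one stage may become a
    -- square at a later one.
    (Sol := fun i d F => (∃ c ∈ F, c * c = d) ∨ PureRepresents F (-1) (p i) d)
    (fun f hf h => ⟨by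
        have := fun n => (h n).1
        have h' : ((⨆ n, f n : Subfield ℂ) : Set ℂ).Countable := by
          rw [Subfield.coe_iSup_of_directed hf.directed_le]
          exact Set.countable_iUnion fun n => (this n).to_set
        exact h'.to_subtype,
      fun n hn => AnisotropicOver.iSup hf fun m => (h m).2 n hn⟩)
    (fun F hF => hF.1)
    (by
      rintro i d F F' hle (⟨c, hc, h⟩ | ⟨x, hx, y, hy, z, hz, h⟩)
      · exact Or.inl ⟨c, hle hc, h⟩
      · exact Or.inr ⟨x, hle hx, y, hle hy, z, hle hz, h⟩)
    (by
      intro F hF i d hd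
      by_cases hsq : ∃ c ∈ F, c * c = d
      · exact ⟨F, le_rfl, hF, Or.inl hsq⟩
      · push Not at hsq
        have hm1 : (-1 : ℂ) ∈ F := neg_mem F.one_mem
        have hanis := hF.2 (p i) (Or.inl ⟨i, rfl⟩)
        obtain ⟨F', h1, h2, h3, h4⟩ := exists_extension_pureRepresents hF.1
          (T := {c | ∃ n ∈ T, c = (-1, (n : ℂ))})
          (by rintro _ ⟨n, hn, rfl⟩; exact ⟨hm1, natCast_mem F n, hF.2 n hn⟩)
          hm1 (natCast_mem F (p i)) hd
          -- A square root `c` of `-1` would make `c + i` a zero of the norm form.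
          (by
            intro c hc h
            have := hanis ⟨c, 1, 0, 0⟩ hc F.one_mem F.zero_mem F.zero_mem
              (by simp [redNorm, pow_two, h])
            exact one_ne_zero (congrArg imI this))
          (by exact_mod_cast (hp i).1.ne_zero) hsq
        exact ⟨F', h1, ⟨h2, fun n hn => h3 _ ⟨n, hn, rfl⟩⟩, Or.inr h4⟩)
    h₀
  have hcast (n : ℕ) (hn : n ∈ T) : NormAnisotropic K (-1) (n : K) := by
    have := hK.2 n hn
    apply AnisotropicOver.normAnisotropic
    push_cast
    exact this
  refine ⟨K, fun s => (p s : K), fun s => hcast _ (Or.inl ⟨s, rfl⟩), fun s t hst => ?_, ?_⟩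
  · have := hcast _ (Or.inr ⟨s, t, hst, rfl⟩)
    push_cast at this
    exact this
  · intro s d
    rcases hsol s d d.2 with ⟨c, hc, h⟩ | ⟨x, hx, y, hy, z, hz, h⟩
    · exact Or.inl ⟨⟨c, hc⟩, Subtype.ext h.symm⟩
    · refine Or.inr ⟨⟨x, hx⟩, ⟨y, hy⟩, ⟨z, hz⟩, Subtype.ext ?_⟩
      push_cast
      exact h

end QuaternionAlgebra

/-! ### Maximal subfields and isomorphism of quaternion algebras. -/

namespace QuaternionAlgebra

variable {k : Type*} [Field k] {a b : k}

theorem NormAnisotropic.isCentral (h2 : (2 : k) ≠ 0) (h : NormAnisotropic k a b) :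
    Algebra.IsCentral k ℍ[k,a,b] where
  out u hu := by
    rw [Algebra.mem_bot]
    by_contra hc
    obtain ⟨z, hz⟩ := exists_not_commute h2 h (u := u) fun c hcu => hc ⟨c, hcu.symm⟩
    exact hz (sub_eq_zero.2 ((Subalgebra.mem_center_iff.1 hu) z))

theorem not_isSquare_of_mul_self (h : NormAnisotropic k a b) {e : ℍ[k,a,b]} {d : k}
    (he : ∀ c : k, e ≠ coe c) (hd : e * e = coe d) : ¬ IsSquare d := by
  rintro ⟨c, rfl⟩
  have hfac : (e - coe c) * (e + coe c) = 0 := by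
    calc _ = e * e + e * coe c - coe c * e - coe c * coe c := by noncomm_ring
      _ = 0 := by rw [coe_commutes, add_sub_cancel_right, hd, ← coe_mul, sub_self]
  rcases h.mul_eq_zero hfac with h | h
  · exact he c (sub_eq_zero.1 h)
  · exact he (-c) (by rw [coe_neg]; exact eq_neg_of_add_eq_zero_left h)

/-- The embedding of `k(√d)` into a quaternion algebra given by a square root of `d`. -/
def quadraticHom {e : ℍ[k,a,b]} {d : k} (hd : e * e = coe d) :
    QuadraticAlgebra k d 0 →ₐ[k] ℍ[k,a,b] :=
  QuadraticAlgebra.lift ⟨e, by rw [hd]; ext <;> simp⟩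

theorem quadraticHom_apply {e : ℍ[k,a,b]} {d : k} (hd : e * e = coe d)
    (z : QuadraticAlgebra k d 0) : quadraticHom hd z = coe z.re + coe z.im * e := by
  change z.re • (1 : ℍ[k,a,b]) + z.im • e = _
  rw [coe_mul_eq_smul]
  congr 1
  ext <;> simp

theorem quadraticHom_injective {e : ℍ[k,a,b]} {d : k} (he : ∀ c : k, e ≠ coe c)
    (hd : e * e = coe d) : Function.Injective (quadraticHom hd) := by
  rw [injective_iff_map_eq_zero]
  intro z hz
  rw [quadraticHom_apply] at hz
  have him : z.im = 0 := by
    by_contra h0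
    apply he (-(z.re / z.im))
    have e0 := congrArg re hz
    have e1 := congrArg imI hz
    have e2 := congrArg imJ hz
    have e3 := congrArg imK hz
    simp [h0] at e0 e1 e2 e3
    ext
    · simp; field_simp; linear_combination e0
    · simp [e1]
    · simp [e2]
    · simp [e3]
  have hre : z.re = 0 := by simpa [him] using congrArg re hz
  ext <;> simp [him, hre]

theorem mem_range_quadraticHom {e z : ℍ[k,a,b]} {d : k} (hd : e * e = coe d) :
    z ∈ (quadraticHom hd).range ↔ ∃ α β : k, z = coe α + coe β * e := by
  constructor
  · rintro ⟨t, rfl⟩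
    exact ⟨_, _, quadraticHom_apply hd t⟩
  · rintro ⟨α, β, rfl⟩
    exact ⟨⟨α, β⟩, quadraticHom_apply hd _⟩

theorem self_mem_range_quadraticHom {e : ℍ[k,a,b]} {d : k} (hd : e * e = coe d) :
    e ∈ (quadraticHom hd).range :=
  (mem_range_quadraticHom hd).2 ⟨0, 1, by simp⟩

/-- A square root of a nonsquare generates a maximal subfield. -/
theorem maximal_range_quadraticHom (h2 : (2 : k) ≠ 0) (h : NormAnisotropic k a b) {e : ℍ[k,a,b]}
    {d : k} (he : ∀ c : k, e ≠ coe c) (hd : e * e = coe d) :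
    Maximal (fun S : Subalgebra k ℍ[k,a,b] => IsField S) (quadraticHom hd).range := by
  constructor
  · have : Fact (∀ r : k, r ^ 2 ≠ d + 0 * r) :=
      ⟨fun r hr => not_isSquare_of_mul_self h he hd ⟨r, by rw [← pow_two, hr]; ring⟩⟩
    exact (AlgEquiv.ofInjective _ (quadraticHom_injective he hd)).symm.toMulEquiv.isField
      (Field.toIsField (QuadraticAlgebra k d 0))
  · intro S hS hle z hz
    have hcomm : z * e = e * z := congrArg Subtype.val
      (hS.mul_comm ⟨z, hz⟩ ⟨e, hle (self_mem_range_quadraticHom hd)⟩)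
    exact (mem_range_quadraticHom hd).2 (exists_eq_add_of_commute h2 h he hcomm)

/-- A maximal subfield is not `k`, since `k(i)` is larger. The pure part of any nonscalar element
has scalar square and generates a subfield that is already maximal. -/
theorem exists_eq_range_quadraticHom (h2 : (2 : k) ≠ 0) (h : NormAnisotropic k a b)
    {S : Subalgebra k ℍ[k,a,b]} (hS : Maximal (fun S : Subalgebra k ℍ[k,a,b] => IsField S) S) :
    ∃ (e : ℍ[k,a,b]) (d : k) (hd : e * e = coe d), (∀ c : k, e ≠ coe c) ∧
      S = (quadraticHom hd).range := by
  obtain ⟨z, hzS, hz⟩ : ∃ z ∈ S, ∀ c : k, z ≠ coe c := by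
    by_contra! hc
    have hi : (⟨0, 1, 0, 0⟩ * ⟨0, 1, 0, 0⟩ : ℍ[k,a,b]) = coe a := by ext <;> simp
    have hi' : ∀ c : k, (⟨0, 1, 0, 0⟩ : ℍ[k,a,b]) ≠ coe c :=
      fun c hc => one_ne_zero (congrArg imI hc)
    have hmax := hS.2 (maximal_range_quadraticHom h2 h hi' hi).1 (by
      intro z hz
      obtain ⟨c, rfl⟩ := hc z hz
      exact (algebraMap_mem (quadraticHom hi).range c))
    obtain ⟨c, hc⟩ := hc _ (hmax (self_mem_range_quadraticHom hi))
    exact hi' c hc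
  have hd : (z - coe z.re) * (z - coe z.re) = coe (-redNorm (z - coe z.re)) :=
    mul_self_of_re_eq_zero (by simp)
  have he : ∀ c : k, z - coe z.re ≠ coe c := fun c hc =>
    hz (c + z.re) (by rw [coe_add]; exact sub_eq_iff_eq_add.1 hc)
  refine ⟨_, _, hd, he, ?_⟩
  have hle : (quadraticHom hd).range ≤ S := by
    intro t ht
    obtain ⟨α, β, rfl⟩ := (mem_range_quadraticHom hd).1 ht
    exact add_mem (algebraMap_mem S α) (mul_mem (algebraMap_mem S β)
      (sub_mem hzS (algebraMap_mem S z.re)))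
  exact le_antisymm ((maximal_range_quadraticHom h2 h he hd).2 hS.1 hle) hle

/-- An isomorphism carries the standard generators to a second pair in `(a, b')`, so `b / b'` is a
norm from `k(√a)`. Then so is `b * b'`, which makes `(a, b * b')` isotropic. -/
theorem isEmpty_algEquiv (h2 : (2 : k) ≠ 0) {b b' : k} (h : NormAnisotropic k a b')
    (hbb : NormAnisotropic k a (b * b')) : IsEmpty (ℍ[k,a,b] ≃ₐ[k] ℍ[k,a,b']) := by
  refine ⟨fun φ => ?_⟩
  have hφ (c : k) : φ (coe c) = coe c := φ.commutes c
  obtain ⟨α, β, hαβ⟩ := exists_norm_ratio h2 h (u := ⟨0, 1, 0, 0⟩) (j := ⟨0, 0, 1, 0⟩)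
    (v := φ ⟨0, 1, 0, 0⟩) (w := φ ⟨0, 0, 1, 0⟩) (A := a) (B := b') (C := b) h.left_ne_zero
    (by ext <;> simp)
    (by rw [← map_mul, ← hφ a]; congr 1; ext <;> simp)
    (by ext <;> simp)
    (by rw [← map_mul, ← hφ b]; congr 1; ext <;> simp)
    (by ext <;> simp)
    (by rw [← map_mul, ← map_mul, ← map_neg]; congr 1; ext <;> simp)
    (fun h0 => one_ne_zero (congrArg imJ h0))
  have := hbb ⟨α * b', β * b', 1, 0⟩ (by simp only [redNorm]; rw [hαβ]; ring)
  exact one_ne_zero (congrArg imJ this)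

end QuaternionAlgebra

open QuaternionAlgebra

/-! ### Comparison of spectra and conclusion. -/

namespace CentralDivisionAlgebra

universe v

variable {k : Type v} [Field k] {a b b' : k}

/-- A quaternion algebra with anisotropic norm form, as a central division algebra. -/
def ofQuaternion (h2 : (2 : k) ≠ 0) (h : NormAnisotropic k a b) : CentralDivisionAlgebra k :=
  letI := h.divisionRing
  { carrier := ℍ[k,a,b]
    divisionRing := h.divisionRing
    algebra := inferInstanceAs (Algebra k ℍ[k,a,b])
    isCentral := h.isCentral h2
    finiteDimensional := inferInstanceAs (Module.Finite k ℍ[k,a,b]) }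

/-- Each maximal subfield is some `k(√d)` with `d` not a square; `hrep` supplies a pure quaternion
of square `d` in the other algebra, generating an isomorphic maximal subfield. -/
theorem spectrum_ofQuaternion_subset (h2 : (2 : k) ≠ 0) (h : NormAnisotropic k a b)
    (h' : NormAnisotropic k a b')
    (hrep : ∀ d, IsSquare d ∨ ∃ x y z : k, a * x ^ 2 + b' * y ^ 2 - a * b' * z ^ 2 = d) :
    (ofQuaternion h2 h).maximalSubfieldSpectrum ⊆ (ofQuaternion h2 h').maximalSubfieldSpectrum := by
  rintro _ ⟨S, hS, rfl⟩
  obtain ⟨e, d, hd, he, rfl⟩ := exists_eq_range_quadraticHom h2 h hS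
  have hdsq := not_isSquare_of_mul_self h he hd
  obtain ⟨x, y, z, hxyz⟩ := (hrep d).resolve_left hdsq
  have hd' : (⟨0, x, y, z⟩ * ⟨0, x, y, z⟩ : ℍ[k,a,b']) = coe d := by
    rw [mul_self_of_re_eq_zero rfl]
    congr 1
    simp only [redNorm]
    linear_combination hxyz
  have he' : ∀ c : k, (⟨0, x, y, z⟩ : ℍ[k,a,b']) ≠ coe c := by
    intro c hc
    rw [hc, ← coe_mul] at hd'
    exact hdsq ⟨c, (coe_injective hd').symm⟩
  let ψ : (quadraticHom hd').range ≃ₐ[k] (quadraticHom hd).range :=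
    (AlgEquiv.ofInjective _ (quadraticHom_injective he' hd')).symm.trans
      (AlgEquiv.ofInjective _ (quadraticHom_injective he hd))
  exact ⟨(quadraticHom hd').range, maximal_range_quadraticHom h2 h' he' hd', Quotient.sound ⟨ψ⟩⟩

end CentralDivisionAlgebra

theorem theoremA :
    ∃ (K : Type) (_ : Field K) (_ : (2 : K) ≠ 0) (D : CentralDivisionAlgebra K),
      D.IsQuaternion ∧ D.genus.Infinite := by
  obtain ⟨K, b, hb, hbb, hrep⟩ := exists_field_family
  have h2 : (2 : K) ≠ 0 := two_ne_zero
  let D : ℕ → CentralDivisionAlgebra K := fun s => CentralDivisionAlgebra.ofQuaternion h2 (hb s)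
  refine ⟨K, inferInstance, h2, D 0,
    ⟨-1, b 0, (hb 0).left_ne_zero, (hb 0).right_ne_zero, ⟨AlgEquiv.refl⟩⟩, ?_⟩
  refine Set.infinite_of_injective_forall_mem (f := fun s => (D s).isoClass) ?_ ?_
  · intro s t hst
    by_contra hne
    obtain ⟨φ⟩ := Quotient.exact hst
    exact (isEmpty_algEquiv h2 (hb t) (hbb s t hne)).false φ
  · exact fun s => ⟨D s, Set.Subset.antisymm
      (CentralDivisionAlgebra.spectrum_ofQuaternion_subset h2 (hb 0) (hb s) (hrep s))
      (CentralDivisionAlgebra.spectrum_ofQuaternion_subset h2 (hb s) (hb 0) (hrep 0)), rfl⟩
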